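/- Let $I=[a,b]$ with $a<b$ denote a compact interval in $\mathbb R$, let $f:I\to I$ be continuous, and let $\mathcal M(I)$ be the space of Borel probability measures on $I$ with the Prokhorov metric $$\mathcal P(\mu,\nu)=\inf\{\epsilon>0:\ \mu(A)\le\nu(A^{\epsilon})+\epsilon \text{ and } \nu(A)\le\mu(A^{\epsilon})+\epsilon \text{ for all Borel } A\subset I\},\qquad A^{\epsilon}=\{x\in I: d(x,A)<\epsilon\}.$$ The induced map $\hat f:\mathcal M(I)\to\mathcal M(I)$ is $\hat f(\mu)(A)=\mu(f^{-1}(A))$. A self-map $T$ of a metric space $X$ is called transitive if for all nonempty open $U,V\subset X$ there is $n\ge 1$ with $T^n(U)\cap V\neq\emptyset$. The period of a periodic point is its least period. (i) For every such $I$ and $f$: if $f$ has a periodic point of odd period different from $1$, then $f$ is transitive if and only if $\hat f$ is transitive. (ii) There exist such an $I$ and a continuous piecewise-linear map $f:I\to I$ (that is, affine on each piece of some subdivision of $I$ into finitely many closed intervals) which has no periodic points of odd period different from $1$ and is transitive, but for which $\hat f$ is not transitive. -/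

import Mathlib

open MeasureTheory

/-- `(X, T)` is (topologically) transitive: for any two nonempty open sets `U`, `V` there is
`n ≥ 1` such that `T^n(U) ∩ V` is nonempty. -/
def IsTransitiveMap {X : Type*} [TopologicalSpace X] (T : X → X) : Prop :=
  ∀ U V : Set X, IsOpen U → IsOpen V → U.Nonempty → V.Nonempty →
    ∃ n : ℕ, 1 ≤ n ∧ ((T^[n] '' U) ∩ V).Nonempty

/-- The space of Borel probability measures on `X`, with the Prokhorov metric. -/
abbrev ProbSpace (X : Type*) [MeasurableSpace X] : Type _ :=
  LevyProkhorov (ProbabilityMeasure X)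

/-- The map induced by a continuous `f` on probability measures: the push-forward
`A ↦ μ (f ⁻¹' A)`. -/
noncomputable def inducedMap {X : Type*} [TopologicalSpace X] [MeasurableSpace X] [BorelSpace X]
    (f : C(X, X)) (μ : ProbSpace X) : ProbSpace X :=
  LevyProkhorov.ofMeasure (μ.toMeasure.map f.continuous.measurable.aemeasurable)

/-- `f` has a periodic point whose (least) period is odd and different from `1`. Points that are
not periodic have `Function.minimalPeriod` equal to `0`, which is even. -/
def HasOddPeriodNeOne {X : Type*} (f : X → X) : Prop :=
  ∃ x : X, Odd (Function.minimalPeriod f x) ∧ Function.minimalPeriod f x ≠ 1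

/-- A self-map of `[a, b]` is piecewise linear: there is a finite subdivision
`a = t 0 < t 1 < ... < t n = b` such that `f` is affine on each `[t i, t (i + 1)]`. -/
def IsPiecewiseLinear {a b : ℝ} (f : Set.Icc a b → Set.Icc a b) : Prop :=
  ∃ (n : ℕ) (t : Fin (n + 1) → ℝ), StrictMono t ∧ t 0 = a ∧ t (Fin.last n) = b ∧
    ∀ i : Fin n, ∃ m c : ℝ, ∀ x : Set.Icc a b,
      t i.castSucc ≤ (x : ℝ) → (x : ℝ) ≤ t i.succ → (f x : ℝ) = m * (x : ℝ) + c

/-!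
The proof goes through finite products: the induced map is transitive as soon as all products
`f × ⋯ × f` are, and conversely transitivity of the induced map gives that of `f`.

*Products to measures.* Empirical measures are dense for the Prokhorov metric, even with a
prescribed large number of points (`exists_dist_empiricalMeasure_le`). Given two open sets of
measures, approximate one measure from each by empirical measures on equally many points; if all
products are transitive, points near those of the first can be sent simultaneously near those of the
second (`isTransitiveMap_inducedMap`). For the converse, `μ ↦ μ U` is lower semicontinuous for open
`U`, and a measure with more than half of its mass in `U` whose image has more than half of its mass
in `V` charges `U ∩ f^[n] ⁻¹' V` (`isTransitiveMap_of_inducedMap`).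

*Intervals.* Let `f` be transitive with a point of odd period greater than one, and let `z` be a
fixed point in the interior. If `E` is a closed interval with `f^[k] E ⊆ E` whose images cover
everything, then all images of `E` are intervals containing `z`. The closures of the unions of the
even and of the odd images are intervals exchanged by `f`; if they met only in `z`, then `f` would
swap the two sides of `z` and have no odd period besides one. So they overlap in an
interval, which by transitivity is everything. As `f` is onto, one of the two endpoints lies in the
`f^[2]`-image of the part on its own side of `z`, hence is inherited by every second image of `E`;
therefore some image contains both endpoints, and `E` is everything
(`IsTransitiveMap.eq_univ_of_mapsTo_iterate`). Applied to closures of unions of iterates, this shows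
that every open interval `J` has a dense orbit under each power of `f`, and that
its iterates reach every interior point. Take an interior point `q ≠ z` with `f^[p] q = q`. For
large `n` the set `f^[p * n] J` contains `z` and `q`, and the interval between them grows under
`f^[p]` with dense union; hence `f^[p * n] J` meets a given open set for all large `n`
(`IsTransitiveMap.exists_eventually_inter_nonempty`), which gives transitivity of all products.

*The example.* The odd zigzag map of `[-1, 1]` exchanges `[-1, 0]` and `[0, 1]`, so it has no odd
period except that of the fixed point `0`. Its affine pieces double distances and cover each half, so
iterated preimages are dense in the appropriate half and the map is transitive. An image of a
measure that gives more than two thirds of its mass to one half again does so for one of the halves, so it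
avoids the nonempty open set of measures giving more than a third to each side of `0`.
-/

/-! ### Transitive maps of a topological space -/

theorem IsTransitiveMap.eq_univ_of_isClosed {X : Type*} [TopologicalSpace X] {f : X → X}
    (hT : IsTransitiveMap f) {K : Set X} (hK : IsClosed K) (hfK : Set.MapsTo f K K)
    (hint : (interior K).Nonempty) : K = Set.univ := by
  by_contra h
  obtain ⟨n, -, -, ⟨x, hx, rfl⟩, hy⟩ := hT (interior K) Kᶜ isOpen_interior hK.isOpen_compl hint
    (Set.nonempty_compl.2 h)
  exact hy (hfK.iterate n (interior_subset hx))

theorem IsTransitiveMap.dense_iUnion_image {X : Type*} [TopologicalSpace X] {f : X → X}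
    (hT : IsTransitiveMap f) {U : Set X} (hU : IsOpen U) (hne : U.Nonempty) :
    Dense (⋃ n, f^[n] '' U) := by
  refine dense_iff_inter_open.2 fun V hV hVne => ?_
  obtain ⟨n, -, y, hyU, hyV⟩ := hT U V hU hV hne hVne
  exact ⟨y, hyV, Set.mem_iUnion.2 ⟨n, hyU⟩⟩

theorem IsTransitiveMap.surjective {X : Type*} [TopologicalSpace X] [CompactSpace X] [T2Space X]
    {f : X → X} (hT : IsTransitiveMap f) (hf : Continuous f) : Function.Surjective f := by
  have hd : Dense (Set.range f) := by
    refine dense_iff_inter_open.2 fun V hV hVne => ?_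
    obtain ⟨n, hn, -, ⟨x, -, rfl⟩, hy⟩ :=
      hT Set.univ V isOpen_univ hV (hVne.mono (Set.subset_univ _)) hVne
    obtain ⟨m, rfl⟩ := Nat.exists_eq_succ_of_ne_zero (by omega : n ≠ 0)
    exact ⟨_, hy, by rw [Function.iterate_succ_apply']; exact Set.mem_range_self _⟩
  rw [← Set.range_eq_univ, ← (isCompact_range hf).isClosed.closure_eq, hd.closure_eq]

theorem image_iterate_add_mul_subset {X : Type*} {f : X → X} {E : Set X} {k : ℕ}
    (hE : Set.MapsTo f^[k] E E) (r j : ℕ) : f^[r + k * j] '' E ⊆ f^[r] '' E := by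
  rintro _ ⟨x, hx, rfl⟩
  rw [Function.iterate_add_apply, Function.iterate_mul]
  exact ⟨_, hE.iterate j hx, rfl⟩

theorem Function.IsFixedPt.mem_image_iterate {X : Type*} {f : X → X} {z : X}
    (hz : Function.IsFixedPt f z) {S : Set X} (hS : z ∈ S) (n : ℕ) : z ∈ f^[n] '' S :=
  ⟨z, hS, hz.iterate n⟩

/-- A point of odd period greater than one cannot have its orbit alternate between two sets that
cover the space and share only one fixed point. -/
theorem HasOddPeriodNeOne.not_swap {X : Type*} {f : X → X} (ho : HasOddPeriodNeOne f)
    {P Q : Set X} (hPQ : Set.MapsTo f P Q) (hQP : Set.MapsTo f Q P) (hu : P ∪ Q = Set.univ)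
    {z : X} (hz : Function.IsFixedPt f z) (hi : ∀ x, x ∈ P → x ∈ Q → x = z) : False := by
  obtain ⟨x, ⟨m, hm⟩, h1⟩ := ho
  have key : ∀ {A B : Set X}, Set.MapsTo f A B → Set.MapsTo f B A → x ∈ A → x ∈ B := by
    intro A B hAB hBA hx
    have h2 : Set.MapsTo f^[2] A A := hBA.comp hAB
    have h : f^[2 * m + 1] x ∈ B := by
      rw [Function.iterate_succ_apply', Function.iterate_mul]
      exact hAB (h2.iterate m hx)
    rwa [← hm, Function.iterate_minimalPeriod] at h
  have hxz : x = z := by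
    rcases (hu ▸ Set.mem_univ x : x ∈ P ∪ Q) with hx | hx
    · exact hi x hx (key hPQ hQP hx)
    · exact hi x (key hQP hPQ hx) hx
  exact h1 (Function.minimalPeriod_eq_one_iff_isFixedPt.2 (hxz ▸ hz))

/-! ### Fixed and periodic points in the interior of an interval -/

theorem Set.OrdConnected.mem_of_dense {X : Type*} [CompleteLinearOrder X]
    [TopologicalSpace X] [OrderTopology X] {S : Set X} (hS : S.OrdConnected) (hd : Dense S) {z : X}
    (h0 : ⊥ < z) (h1 : z < ⊤) : z ∈ S := by
  obtain ⟨x, hxz, hx⟩ := hd.inter_open_nonempty (Set.Iio z) isOpen_Iio ⟨⊥, h0⟩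
  obtain ⟨y, hyz, hy⟩ := hd.inter_open_nonempty (Set.Ioi z) isOpen_Ioi ⟨⊤, h1⟩
  exact hS.out hx hy ⟨le_of_lt hxz, le_of_lt hyz⟩

theorem isFixedPt_of_monotone_orbit {X : Type*} [PartialOrder X] {f : X → X} {x : X} {p : ℕ}
    (hp : 1 ≤ p) (hx : f^[p] x = x)
    (h : (∀ n, f^[n] x ≤ f (f^[n] x)) ∨ (∀ n, f (f^[n] x) ≤ f^[n] x)) :
    Function.IsFixedPt f x := by
  rcases h with h | h
  · have hm : Monotone fun n => f^[n] x := monotone_nat_of_le_succ fun n => by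
      simpa only [Function.iterate_succ_apply'] using h n
    have h1 : f x ≤ f^[p] x := hm hp
    rw [hx] at h1
    exact le_antisymm h1 (h 0)
  · have hm : Antitone fun n => f^[n] x := antitone_nat_of_succ_le fun n => by
      simpa only [Function.iterate_succ_apply'] using h n
    have h1 : f^[p] x ≤ f x := hm hp
    rw [hx] at h1
    exact le_antisymm (h 0) h1

section Interval

variable {X : Type*} [CompleteLinearOrder X] [DenselyOrdered X] [TopologicalSpace X]
  [OrderTopology X] {f : X → X}

theorem Set.OrdConnected.interior_nonempty {S : Set X} (hS : S.OrdConnected) {x y : X}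
    (hx : x ∈ S) (hy : y ∈ S) (hxy : x ≠ y) : (interior S).Nonempty := by
  wlog h : x < y generalizing x y
  · exact this hy hx hxy.symm (lt_of_le_of_ne (not_lt.1 h) hxy.symm)
  exact (Set.nonempty_Ioo.2 h).mono
    (interior_maximal (Set.Ioo_subset_Icc_self.trans (hS.out hx hy)) isOpen_Ioo)

/-- The orbit of a point of odd period greater than one moves both up and down, so there is a fixed
point strictly between two of its points; having at least three points, the orbit has a point that
is not an endpoint. -/
theorem HasOddPeriodNeOne.exists_interior_points (ho : HasOddPeriodNeOne f) (hf : Continuous f) :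
    ∃ z q : X, Function.IsFixedPt f z ∧ ⊥ < z ∧ z < ⊤ ∧ ⊥ < q ∧ q < ⊤ ∧ q ≠ z ∧
      ∃ p, 1 ≤ p ∧ f^[p] q = q := by
  obtain ⟨x, hodd, h1⟩ := ho
  set p := Function.minimalPeriod f x with hpdef
  have hp3 : 3 ≤ p := by obtain ⟨m, hm⟩ := hodd; omega
  have hxp : f^[p] x = x := Function.iterate_minimalPeriod
  have hnf : ¬ Function.IsFixedPt f x := fun h =>
    h1 (Function.minimalPeriod_eq_one_iff_isFixedPt.2 h)
  have hper : ∀ i, f^[p] (f^[i] x) = f^[i] x := fun i => by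
    rw [← Function.iterate_add_apply, add_comm, Function.iterate_add_apply, hxp]
  have hnfi : ∀ i, ¬ Function.IsFixedPt f (f^[i] x) := by
    intro i hi
    have h2 : f^[i * (p - 1)] (f^[i] x) = f^[i] x := hi.iterate _
    rw [← Function.iterate_add_apply, show i * (p - 1) + i = p * i by
      obtain ⟨s, hs⟩ := Nat.exists_eq_add_of_le hp3
      rw [hs, show 3 + s - 1 = 2 + s by omega]; ring, Function.iterate_mul,
      Function.iterate_fixed hxp] at h2
    exact hnf (h2 ▸ hi)
  obtain ⟨i, hi⟩ : ∃ i, f^[i] x < f (f^[i] x) := by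
    by_contra! h
    exact hnf (isFixedPt_of_monotone_orbit (by omega) hxp (Or.inr h))
  obtain ⟨j, hj⟩ : ∃ j, f (f^[j] x) < f^[j] x := by
    by_contra! h
    exact hnf (isFixedPt_of_monotone_orbit (by omega) hxp (Or.inl h))
  obtain ⟨z, hzm, hz⟩ := (isPreconnected_uIcc (a := f^[i] x) (b := f^[j] x)).intermediate_value₂
    Set.left_mem_uIcc Set.right_mem_uIcc continuousOn_id hf.continuousOn hi.le hj.le
  have hzf : Function.IsFixedPt f z := hz.symm
  have hne : ∀ n, f^[n] x ≠ z := fun n h => hnfi n (h ▸ hzf)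
  have hb : ⊥ < z := by
    refine bot_lt_iff_ne_bot.2 fun h => ?_
    rcases min_le_iff.1 (Set.mem_Icc.1 hzm).1 with h' | h' <;>
    exact hne _ (by rw [h] at h' ⊢; exact le_bot_iff.1 h')
  have ht : z < ⊤ := by
    refine lt_top_iff_ne_top.2 fun h => ?_
    rcases le_max_iff.1 (Set.mem_Icc.1 hzm).2 with h' | h' <;>
    exact hne _ (by rw [h] at h' ⊢; exact top_le_iff.1 h')
  have hinj := Function.iterate_injOn_Iio_minimalPeriod (f := f) (x := x)
  have h01 : f^[0] x ≠ f^[1] x := fun h => by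
    have := hinj (show 0 ∈ Set.Iio p by simp; omega) (show 1 ∈ Set.Iio p by simp; omega) h
    omega
  have h02 : f^[0] x ≠ f^[2] x := fun h => by
    have := hinj (show 0 ∈ Set.Iio p by simp; omega) (show 2 ∈ Set.Iio p by simp; omega) h
    omega
  have h12 : f^[1] x ≠ f^[2] x := fun h => by
    have := hinj (show 1 ∈ Set.Iio p by simp; omega) (show 2 ∈ Set.Iio p by simp; omega) h
    omega
  obtain ⟨n, hn0, hn1⟩ : ∃ n, f^[n] x ≠ ⊥ ∧ f^[n] x ≠ ⊤ := by
    by_contra! h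
    have a0 := h 0
    have a1 := h 1
    have a2 := h 2
    by_cases b0 : f^[0] x = ⊥
    · have b1 : f^[1] x ≠ ⊥ := fun h => h01 (b0.trans h.symm)
      have b2 : f^[2] x ≠ ⊥ := fun h => h02 (b0.trans h.symm)
      exact h12 ((a1 b1).trans (a2 b2).symm)
    · by_cases b1 : f^[1] x = ⊥
      · have b2 : f^[2] x ≠ ⊥ := fun h => h12 (b1.trans h.symm)
        exact h02 ((a0 b0).trans (a2 b2).symm)
      · exact h01 ((a0 b0).trans (a1 b1).symm)
  exact ⟨z, f^[n] x, hzf, hb, ht, bot_lt_iff_ne_bot.2 hn0, lt_top_iff_ne_top.2 hn1, hne n, p,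
    by omega, hper n⟩

/-! ### Total transitivity -/

/-- The closures `P` and `Q` of the unions of the even and of the odd iterates of `E` are intervals
containing the fixed point `z` that `f` exchanges. Either `P ∩ Q` has an interior point, and then
it is everything by transitivity, or `P ∩ Q = {z}`, which an odd period excludes. -/
theorem IsTransitiveMap.dense_iUnion_even_iterates (hT : IsTransitiveMap f) (hf : Continuous f)
    (ho : HasOddPeriodNeOne f) {z : X} (hz : Function.IsFixedPt f z) {E : Set X}
    (hE : IsPreconnected E) (hzE : z ∈ E) (hd : Dense (⋃ n, f^[n] '' E)) :
    Dense (⋃ n, f^[2 * n] '' E) := by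
  set P := closure (⋃ n, f^[2 * n] '' E) with hP
  set Q := closure (⋃ n, f^[2 * n + 1] '' E) with hQ
  have hconn : ∀ a : ℕ → ℕ, (closure (⋃ n, f^[a n] '' E)).OrdConnected := fun a =>
    (isPreconnected_iUnion ⟨z, Set.mem_iInter.2 fun n => hz.mem_image_iterate hzE _⟩
      fun n => hE.image _ (hf.iterate _).continuousOn).closure.ordConnected
  have hmem : ∀ a : ℕ → ℕ, z ∈ closure (⋃ n, f^[a n] '' E) := fun a =>
    subset_closure (Set.mem_iUnion.2 ⟨0, hz.mem_image_iterate hzE _⟩)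
  have hPQ : Set.MapsTo f P Q := by
    refine Set.MapsTo.closure ?_ hf
    intro x hx
    obtain ⟨n, y, hy, rfl⟩ := Set.mem_iUnion.1 hx
    exact Set.mem_iUnion.2 ⟨n, y, hy, by rw [Function.iterate_succ_apply']⟩
  have hQP : Set.MapsTo f Q P := by
    refine Set.MapsTo.closure ?_ hf
    intro x hx
    obtain ⟨n, y, hy, rfl⟩ := Set.mem_iUnion.1 hx
    exact Set.mem_iUnion.2 ⟨n + 1, y, hy, by
      rw [← Function.iterate_succ_apply' f]; rfl⟩
  have hu : P ∪ Q = Set.univ := by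
    rw [hP, hQ, ← closure_union]
    refine Set.eq_univ_of_subset (closure_mono ?_) hd.closure_eq
    refine Set.iUnion_subset fun n => ?_
    rcases Nat.even_or_odd' n with ⟨m, rfl | rfl⟩
    · exact (Set.subset_iUnion (fun n => f^[2 * n] '' E) m).trans Set.subset_union_left
    · exact (Set.subset_iUnion (fun n => f^[2 * n + 1] '' E) m).trans Set.subset_union_right
  by_cases hi : ∀ x, x ∈ P → x ∈ Q → x = z
  · exact (ho.not_swap hPQ hQP hu hz hi).elim
  · push Not at hi
    obtain ⟨x, hxP, hxQ, hxz⟩ := hi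
    have hoc : (P ∩ Q).OrdConnected := (hconn _).inter (hconn _)
    have := hT.eq_univ_of_isClosed (isClosed_closure.inter isClosed_closure)
      (fun y hy => ⟨hQP hy.2, hPQ hy.1⟩)
      (hoc.interior_nonempty ⟨hxP, hxQ⟩ ⟨hmem _, hmem _⟩ hxz)
    rw [dense_iff_closure_eq, ← hP]
    exact Set.eq_univ_of_subset Set.inter_subset_left this

/-- An interval `E` invariant under `f^[k]` whose iterates cover the whole interval is itself the
whole interval. -/
theorem IsTransitiveMap.eq_univ_of_mapsTo_iterate (hT : IsTransitiveMap f) (hf : Continuous f)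
    (ho : HasOddPeriodNeOne f) {z : X} (hz : Function.IsFixedPt f z) {E : Set X}
    (hE : IsPreconnected E) (hcl : IsClosed E) {k : ℕ} (hk : 1 ≤ k)
    (hfE : Set.MapsTo f^[k] E E) (hu : ⋃ n, f^[n] '' E = Set.univ) : E = Set.univ := by
  have hsurj := hT.surjective hf
  have hsub := image_iterate_add_mul_subset hfE
  have hzE : z ∈ E := by
    obtain ⟨r, x, hx, hr⟩ := Set.mem_iUnion.1 (hu ▸ Set.mem_univ z)
    have h1 : z ∈ f^[0] '' E := by
      refine hsub 0 r ⟨x, hx, ?_⟩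
      obtain ⟨s, hs⟩ := Nat.exists_eq_add_of_le (Nat.le_mul_of_pos_left r hk)
      rw [zero_add, hs, add_comm, Function.iterate_add_apply, hr]
      exact hz.iterate s
    simpa using h1
  have hoc : ∀ r, (f^[r] '' E).OrdConnected := fun r =>
    (hE.image _ (hf.iterate _).continuousOn).ordConnected
  -- The iterates of `E` are periodic in the weak sense of `hsub`, so a union of them is closed.
  have hclosed : ∀ {F : Set X}, IsClosed F → Set.MapsTo f^[k] F F →
      IsClosed (⋃ n, f^[2 * n] '' F) := by
    intro F hF hFk
    have h : ⋃ n, f^[2 * n] '' F = ⋃ n ∈ Finset.range k, f^[2 * n] '' F := by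
      refine subset_antisymm (Set.iUnion_subset fun n => ?_)
        (Set.iUnion₂_subset fun n _ => Set.subset_iUnion (fun n => f^[2 * n] '' F) n)
      have h1 := image_iterate_add_mul_subset hFk (2 * (n % k)) (2 * (n / k))
      rw [show 2 * (n % k) + k * (2 * (n / k)) = 2 * n by
        conv_rhs => rw [← Nat.mod_add_div n k]
        ring] at h1
      exact h1.trans (Set.subset_biUnion_of_mem (u := fun n => f^[2 * n] '' F)
        (Finset.mem_coe.2 (Finset.mem_range.2 (Nat.mod_lt n hk))))
    rw [h]
    exact isClosed_biUnion_finset fun n _ =>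
      (hF.isCompact.image (hf.iterate _)).isClosed
  have heven : ∀ w : X, ∃ n, w ∈ f^[2 * n] '' E := fun w => by
    have hd : Dense (⋃ n, f^[2 * n] '' E) :=
      hT.dense_iUnion_even_iterates hf ho hz hE hzE (by rw [hu]; exact dense_univ)
    have : ⋃ n, f^[2 * n] '' E = Set.univ := (hclosed hcl hfE).closure_eq ▸ hd.closure_eq
    exact Set.mem_iUnion.1 (this ▸ Set.mem_univ w)
  have hodd : ∀ w : X, ∃ n, w ∈ f^[2 * n + 1] '' E := fun w => by
    obtain ⟨v, rfl⟩ := hsurj w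
    obtain ⟨n, x, hx, rfl⟩ := heven v
    exact ⟨n, x, hx, by rw [Function.iterate_succ_apply']⟩
  -- Two points one of which is inherited by every second iterate lie in a common iterate.
  have key : ∀ w w' : X, (∀ r, w ∈ f^[r] '' E → w ∈ f^[r + 2] '' E) →
      ∃ s, w ∈ f^[s] '' E ∧ w' ∈ f^[s] '' E := by
    intro w w' hw
    obtain ⟨r, hr⟩ := heven w
    obtain ⟨s, hs⟩ := heven w'
    have hall : ∀ j, w ∈ f^[2 * r + 2 * j] '' E := by
      intro j
      induction j with
      | zero => exact hr
      | succ j ih => exact hw _ ih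
    refine ⟨2 * s, hsub (2 * s) (2 * r) ?_, hs⟩
    obtain ⟨t, ht⟩ := Nat.exists_eq_add_of_le (Nat.le_mul_of_pos_left r hk)
    rw [show 2 * s + k * (2 * r) = 2 * r + 2 * (s + t) by
      rw [show k * (2 * r) = 2 * (k * r) by ring, ht]; ring]
    exact hall _
  have hzr : ∀ r, z ∈ f^[r] '' E := fun r => hz.mem_image_iterate hzE r
  have himg : ∀ r m, f^[m] '' (f^[r] '' E) = f^[r + m] '' E := fun r m => by
    rw [← Set.image_comp, ← Function.iterate_add, add_comm]
  have hcon : ∀ S : Set X, IsPreconnected S → (f '' S).OrdConnected := fun S hS =>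
    (hS.image _ hf.continuousOn).ordConnected
  have hendpt : ∃ s, ⊥ ∈ f^[s] '' E ∧ ⊤ ∈ f^[s] '' E := by
    have hlow : ⊥ ∈ f^[2] '' Set.Icc ⊥ z → ∃ s, ⊥ ∈ f^[s] '' E ∧ ⊤ ∈ f^[s] '' E := fun h =>
      key ⊥ ⊤ fun r hr => himg r 2 ▸ Set.image_mono ((hoc r).out hr (hzr r)) h
    have hhigh : ⊤ ∈ f^[2] '' Set.Icc z ⊤ → ∃ s, ⊥ ∈ f^[s] '' E ∧ ⊤ ∈ f^[s] '' E := fun h => by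
      obtain ⟨s, h1, h2⟩ :=
        key ⊤ ⊥ fun r hr => himg r 2 ▸ Set.image_mono ((hoc r).out (hzr r) hr) h
      exact ⟨s, h2, h1⟩
    have hzlow : z ∈ f '' Set.Icc ⊥ z := ⟨z, ⟨bot_le, le_rfl⟩, hz⟩
    have hzhigh : z ∈ f '' Set.Icc z ⊤ := ⟨z, ⟨le_rfl, le_top⟩, hz⟩
    have hside : ∀ w, w ∈ f '' Set.Icc ⊥ z ∨ w ∈ f '' Set.Icc z ⊤ := fun w => by
      obtain ⟨v, rfl⟩ := hsurj w
      rcases le_total v z with h | h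
      · exact Or.inl ⟨v, ⟨bot_le, h⟩, rfl⟩
      · exact Or.inr ⟨v, ⟨h, le_top⟩, rfl⟩
    have h2 : ∀ S : Set X, f^[2] '' S = f '' (f '' S) := fun S => by
      rw [← Set.image_comp]; rfl
    -- Unless an endpoint is attained on its own side of `z`, both are attained across `z`.
    rcases hside ⊥ with hb | hb
    · apply hlow
      rw [h2]
      exact Set.image_mono ((hcon _ isPreconnected_Icc).out hb hzlow) hb
    · rcases hside ⊤ with ht | ht
      · apply hlow
        rw [h2]
        exact Set.image_mono ((hcon _ isPreconnected_Icc).out hzlow ht) hb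
      · apply hhigh
        rw [h2]
        exact Set.image_mono ((hcon _ isPreconnected_Icc).out hzhigh ht) ht
  obtain ⟨s, hb, ht⟩ := hendpt
  have hs : f^[s] '' E = Set.univ := Set.eq_univ_of_forall fun x =>
    (hoc s).out hb ht ⟨bot_le, le_top⟩
  have h1 : f^[0 + k * s] '' E = Set.univ := by
    obtain ⟨t, ht⟩ := Nat.exists_eq_add_of_le (Nat.le_mul_of_pos_left s hk)
    rw [zero_add, ht, ← himg, hs, Set.image_univ, (hsurj.iterate t).range_eq]
  simpa using Set.eq_univ_of_subset (hsub 0 s) h1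

/-- Total transitivity: if the orbit of `J` under `f` is dense, then so is its orbit under `f^[k]`,
as soon as the latter is connected. -/
theorem IsTransitiveMap.dense_iUnion_iterate_iterate (hT : IsTransitiveMap f) (hf : Continuous f)
    (ho : HasOddPeriodNeOne f) {z : X} (hz : Function.IsFixedPt f z) {J : Set X}
    (hJ : Dense (⋃ n, f^[n] '' J)) {k : ℕ} (hk : 1 ≤ k)
    (hconn : IsPreconnected (⋃ j, f^[k * j] '' J)) : Dense (⋃ j, f^[k * j] '' J) := by
  set W := ⋃ j, f^[k * j] '' J with hW
  have hmaps : Set.MapsTo f^[k] W W := by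
    intro x hx
    obtain ⟨j, y, hy, rfl⟩ := Set.mem_iUnion.1 hx
    exact Set.mem_iUnion.2 ⟨j + 1, y, hy, by
      rw [mul_add, mul_one, add_comm, Function.iterate_add_apply]⟩
  have hmaps' : Set.MapsTo f^[k] (closure W) (closure W) := hmaps.closure (hf.iterate k)
  have hJW : J ⊆ closure W := fun x hx => subset_closure (Set.mem_iUnion.2 ⟨0, x, hx, rfl⟩)
  rw [dense_iff_closure_eq]
  refine hT.eq_univ_of_mapsTo_iterate hf ho hz hconn.closure isClosed_closure hk hmaps' ?_
  have h : ⋃ n, f^[n] '' closure W = ⋃ n ∈ Finset.range k, f^[n] '' closure W := by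
    refine subset_antisymm (Set.iUnion_subset fun n => ?_)
      (Set.iUnion₂_subset fun n _ => Set.subset_iUnion (fun n => f^[n] '' closure W) n)
    have h1 := image_iterate_add_mul_subset hmaps' (n % k) (n / k)
    rw [Nat.mod_add_div] at h1
    exact h1.trans (Set.subset_biUnion_of_mem (u := fun n => f^[n] '' closure W)
      (Finset.mem_coe.2 (Finset.mem_range.2 (Nat.mod_lt n hk))))
  have hc : IsClosed (⋃ n, f^[n] '' closure W) := by
    rw [h]
    exact isClosed_biUnion_finset fun n _ =>
      (isClosed_closure.isCompact.image (hf.iterate _)).isClosed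
  rw [← hc.closure_eq]
  exact (hJ.mono (Set.iUnion_mono fun n => Set.image_mono hJW)).closure_eq

/-- Since `f^[m] '' U` meets `U` for some `m ≥ 1`, the union of the images under the iterates of
`f^[m]` is a chain of intervals, hence a dense interval, and so contains every interior point. -/
theorem IsTransitiveMap.exists_fixedPt_mem_iterate (hT : IsTransitiveMap f) (hf : Continuous f)
    (ho : HasOddPeriodNeOne f) {z : X} (hz : Function.IsFixedPt f z) (h0 : ⊥ < z) (h1 : z < ⊤)
    {U : Set X} (hU : IsOpen U) (hc : IsPreconnected U) (hne : U.Nonempty) :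
    ∃ n, z ∈ f^[n] '' U := by
  obtain ⟨m, hm, y, ⟨x, hx, hxy⟩, hy⟩ := hT U U hU hU hne hne
  have hconn : IsPreconnected (⋃ j, f^[m * j] '' U) := by
    refine IsPreconnected.iUnion_of_chain (fun j => hc.image _ (hf.iterate _).continuousOn)
      fun j => ⟨f^[m * j] y, ⟨y, hy, rfl⟩, x, hx, ?_⟩
    rw [← hxy, ← Function.iterate_add_apply]
    rfl
  have hd := hT.dense_iUnion_iterate_iterate hf ho hz (hT.dense_iUnion_image hU hne) hm hconn
  obtain ⟨j, hj⟩ := Set.mem_iUnion.1 (hconn.ordConnected.mem_of_dense hd h0 h1)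
  exact ⟨_, hj⟩

/-- Once an iterate of `U` contains the fixed point `z`, all later ones do, so the union of those
along the multiples of `k` is again a dense interval. -/
theorem IsTransitiveMap.exists_mem_iterate_mul (hT : IsTransitiveMap f) (hf : Continuous f)
    (ho : HasOddPeriodNeOne f) {z : X} (hz : Function.IsFixedPt f z) (h0 : ⊥ < z) (h1 : z < ⊤)
    {U : Set X} (hU : IsOpen U) (hc : IsPreconnected U) (hne : U.Nonempty) {k : ℕ} (hk : 1 ≤ k)
    {q : X} (hq0 : ⊥ < q) (hq1 : q < ⊤) : ∃ j, q ∈ f^[k * j] '' U := by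
  obtain ⟨n, y, hy, hyz⟩ := hT.exists_fixedPt_mem_iterate hf ho hz h0 h1 hU hc hne
  have hzL : z ∈ f^[k * n] '' U := by
    obtain ⟨s, hs⟩ := Nat.exists_eq_add_of_le (Nat.le_mul_of_pos_left n hk)
    exact ⟨y, hy, by rw [hs, add_comm, Function.iterate_add_apply, hyz]; exact hz.iterate s⟩
  have himg : ∀ i, f^[i] '' (f^[k * n] '' U) = f^[k * n] '' (f^[i] '' U) := fun i => by
    rw [← Set.image_comp, ← Function.iterate_add, add_comm, Function.iterate_add, Set.image_comp]
  have hd : Dense (⋃ i, f^[i] '' (f^[k * n] '' U)) := by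
    simp_rw [himg]
    rw [← Set.image_iUnion]
    exact ((hT.surjective hf).iterate _).denseRange.dense_image (hf.iterate _)
      (hT.dense_iUnion_image hU hne)
  have hconn : IsPreconnected (⋃ j, f^[k * j] '' (f^[k * n] '' U)) :=
    isPreconnected_iUnion ⟨z, Set.mem_iInter.2 fun j => hz.mem_image_iterate hzL _⟩ fun j =>
      (hc.image _ (hf.iterate _).continuousOn).image _ (hf.iterate _).continuousOn
  obtain ⟨j, hj⟩ := Set.mem_iUnion.1 (hconn.ordConnected.mem_of_dense
    (hT.dense_iUnion_iterate_iterate hf ho hz hd hk hconn) hq0 hq1)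
  refine ⟨j + n, ?_⟩
  rwa [← Set.image_comp, ← Function.iterate_add, ← mul_add] at hj

/-! ### Simultaneous transitivity -/

/-- Along the multiples of some `p`, the iterates of every open set eventually meet every open set.
The iterates of `U` eventually contain a fixed point `z` and a point `q` with `f^[p] q = q`, and
the interval between `z` and `q` grows under `f^[p]`. -/
theorem IsTransitiveMap.exists_eventually_inter_nonempty (hT : IsTransitiveMap f)
    (hf : Continuous f) (ho : HasOddPeriodNeOne f) :
    ∃ p, 1 ≤ p ∧ ∀ U V : Set X, IsOpen U → IsOpen V → U.Nonempty → V.Nonempty →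
      ∃ N, ∀ n, N ≤ n → (f^[p * n] '' U ∩ V).Nonempty := by
  obtain ⟨z, q, hz, hz0, hz1, hq0, hq1, hqz, p, hp, hqp⟩ := ho.exists_interior_points hf
  refine ⟨p, hp, fun U V hU hV hUne hVne => ?_⟩
  have : Nontrivial X := ⟨q, z, hqz⟩
  obtain ⟨a, b, hab, hsub⟩ := hU.exists_Ioo_subset hUne
  have hJne : (Set.Ioo a b).Nonempty := Set.nonempty_Ioo.2 hab
  obtain ⟨j₁, y₁, hy₁, hj₁⟩ := hT.exists_mem_iterate_mul hf ho hz hz0 hz1 isOpen_Ioo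
    isPreconnected_Ioo hJne hp hz0 hz1
  obtain ⟨j₂, y₂, hy₂, hj₂⟩ := hT.exists_mem_iterate_mul hf ho hz hz0 hz1 isOpen_Ioo
    isPreconnected_Ioo hJne hp hq0 hq1
  have hgz : ∀ i, f^[p * i] z = z := fun i => hz.iterate _
  have hgq : ∀ i, f^[p * i] q = q := fun i => by
    rw [Function.iterate_mul, Function.iterate_fixed hqp]
  have hadd : ∀ i j x, f^[p * (i + j)] x = f^[p * i] (f^[p * j] x) := fun i j x => by
    rw [mul_add, Function.iterate_add_apply]
  have hgrow : ∀ i, Set.uIcc z q ⊆ f^[p * i] '' Set.uIcc z q := fun i =>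
    (isPreconnected_uIcc.image _ (hf.iterate _).continuousOn).ordConnected.uIcc_subset
      ⟨z, Set.left_mem_uIcc, hgz i⟩ ⟨q, Set.right_mem_uIcc, hgq i⟩
  have hd : Dense (⋃ n, f^[n] '' Set.uIcc z q) :=
    (hT.dense_iUnion_image isOpen_interior (Set.ordConnected_uIcc.interior_nonempty
      Set.right_mem_uIcc Set.left_mem_uIcc hqz)).mono
      (Set.iUnion_mono fun n => Set.image_mono interior_subset)
  have hd' := hT.dense_iUnion_iterate_iterate hf ho hz hd hp
    (isPreconnected_iUnion ⟨z, Set.mem_iInter.2 fun j => hz.mem_image_iterate Set.left_mem_uIcc _⟩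
      fun j => isPreconnected_uIcc.image _ (hf.iterate _).continuousOn)
  obtain ⟨y, hyV, hy⟩ := hd'.inter_open_nonempty V hV hVne
  obtain ⟨i, hi⟩ := Set.mem_iUnion.1 hy
  refine ⟨i + (j₁ + j₂), fun n hn => ⟨y, ?_, hyV⟩⟩
  have hL : Set.uIcc z q ⊆ f^[p * (j₁ + j₂)] '' U := by
    refine ((isPreconnected_Ioo.image _ (hf.iterate _).continuousOn).ordConnected.uIcc_subset
      ⟨y₁, hy₁, ?_⟩ ⟨y₂, hy₂, ?_⟩).trans (Set.image_mono hsub)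
    · rw [add_comm j₁ j₂, hadd, hj₁, hgz]
    · rw [hadd, hj₂, hgq]
  obtain ⟨d, rfl⟩ := Nat.exists_eq_add_of_le hn
  obtain ⟨v, hv, rfl⟩ := hi
  obtain ⟨w, hw, rfl⟩ := hgrow d hv
  obtain ⟨u, hu, rfl⟩ := hL hw
  refine ⟨u, hu, ?_⟩
  rw [show i + (j₁ + j₂) + d = i + (d + (j₁ + j₂)) by ring, hadd, hadd]

/-- All finite products of `f` with itself are transitive. -/
theorem IsTransitiveMap.exists_forall_inter_nonempty (hT : IsTransitiveMap f)
    (hf : Continuous f) (ho : HasOddPeriodNeOne f) {ι : Type*} [Fintype ι] (U V : ι → Set X)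
    (hU : ∀ i, IsOpen (U i)) (hV : ∀ i, IsOpen (V i)) (hUne : ∀ i, (U i).Nonempty)
    (hVne : ∀ i, (V i).Nonempty) :
    ∃ n, 1 ≤ n ∧ ∀ i, (f^[n] '' U i ∩ V i).Nonempty := by
  obtain ⟨p, hp, h⟩ := hT.exists_eventually_inter_nonempty hf ho
  choose N hN using fun i => h (U i) (V i) (hU i) (hV i) (hUne i) (hVne i)
  refine ⟨p * (Finset.univ.sup N + 1), Nat.mul_pos hp (Nat.succ_pos _), fun i => hN i _ ?_⟩
  exact (Finset.le_sup (Finset.mem_univ i)).trans (Nat.le_succ _)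

end Interval

/-! ### Empirical measures and the Prokhorov metric -/

/-- The uniform probability measure on the points `z 0, ..., z N`, counted with multiplicity. The
`N + 1` points keep the index type nonempty. -/
noncomputable def empiricalMeasure {X : Type*} [MeasurableSpace X] {N : ℕ} (z : Fin (N + 1) → X) :
    ProbabilityMeasure X :=
  ProbabilityMeasure.map
    ⟨ProbabilityTheory.uniformOn (Set.univ : Set (Fin (N + 1))),
      ProbabilityTheory.isProbabilityMeasure_uniformOn Set.finite_univ Set.univ_nonempty⟩
    (f := z) (measurable_of_finite z).aemeasurable

theorem empiricalMeasure_real {X : Type*} [MeasurableSpace X] {N : ℕ} (z : Fin (N + 1) → X)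
    {B : Set X} (hB : MeasurableSet B) :
    (empiricalMeasure z : Measure X).real B = ((z ⁻¹' B).ncard : ℝ) / (N + 1) := by
  classical
  have h : (empiricalMeasure z : Measure X) B =
      ProbabilityTheory.uniformOn (Set.univ : Set (Fin (N + 1))) (z ⁻¹' B) :=
    Measure.map_apply (measurable_of_finite z) hB
  rw [Measure.real, h, ProbabilityTheory.uniformOn_univ,
    Measure.count_apply (Set.toFinite _).measurableSet, ENNReal.toReal_div]
  congr 1
  · rw [← (Set.toFinite _).cast_ncard_eq]
    rfl
  · rw [Fintype.card_fin, ENNReal.toReal_natCast, Nat.cast_succ]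

theorem iterate_inducedMap {X : Type*} [TopologicalSpace X] [MeasurableSpace X] [BorelSpace X]
    (f : C(X, X)) (n : ℕ) (μ : ProbSpace X) :
    (inducedMap f)^[n] μ = LevyProkhorov.ofMeasure (μ.toMeasure.map
      (f.continuous.iterate n).measurable.aemeasurable) := by
  induction n with
  | zero =>
    apply LevyProkhorov.toMeasure_injective
    apply Subtype.ext
    exact (Measure.map_id).symm
  | succ n ih =>
    rw [Function.iterate_succ_apply', ih]
    apply LevyProkhorov.toMeasure_injective
    apply Subtype.ext
    refine (Measure.map_map f.continuous.measurable (f.continuous.iterate n).measurable).trans ?_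
    rw [← Function.iterate_succ']
    rfl

theorem iterate_inducedMap_apply {X : Type*} [TopologicalSpace X] [MeasurableSpace X]
    [BorelSpace X] (f : C(X, X)) (n : ℕ) (μ : ProbSpace X) {B : Set X} (hB : MeasurableSet B) :
    (((inducedMap f)^[n] μ).toMeasure : Measure X) B =
      (μ.toMeasure : Measure X) (f^[n] ⁻¹' B) := by
  rw [iterate_inducedMap]
  exact Measure.map_apply (f.continuous.iterate n).measurable hB

theorem iterate_inducedMap_empiricalMeasure {X : Type*} [TopologicalSpace X] [MeasurableSpace X]
    [BorelSpace X] (f : C(X, X)) (n : ℕ) {N : ℕ} (z : Fin (N + 1) → X) :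
    (inducedMap f)^[n] (LevyProkhorov.ofMeasure (empiricalMeasure z)) =
      LevyProkhorov.ofMeasure (empiricalMeasure (f^[n] ∘ z)) := by
  rw [iterate_inducedMap]
  apply LevyProkhorov.toMeasure_injective
  apply Subtype.ext
  exact Measure.map_map (f.continuous.iterate n).measurable (measurable_of_finite z)

theorem isOpen_setOf_lt_measure {X : Type*} [PseudoMetricSpace X] [MeasurableSpace X]
    [BorelSpace X] {G : Set X} (hG : IsOpen G) (c : ENNReal) :
    IsOpen {μ : ProbSpace X | c < (μ.toMeasure : Measure X) G} := by
  refine isOpen_iff_mem_nhds.2 fun μ hμ => ?_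
  have h := ProbabilityMeasure.le_liminf_measure_open_of_tendsto
    (LevyProkhorov.continuous_toMeasure_probabilityMeasure.tendsto μ) hG
  exact Filter.eventually_lt_of_lt_liminf (lt_of_lt_of_le hμ h)

/-- On a compact space every probability measure is close to all empirical measures of
suitable configurations of sufficiently many points, even after a small perturbation of these
points. Cut the space into finitely many small pieces `A j`; a piece receives
`⌊(N + 1) * μ (A j)⌋` points, and the remaining points, fewer than there are pieces,
carry little mass. -/
theorem exists_dist_empiricalMeasure_le {X : Type*} [MetricSpace X] [CompactSpace X]
    [Nonempty X] [MeasurableSpace X] [BorelSpace X] (μ : ProbSpace X) {ε : ℝ} (hε : 0 < ε) :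
    ∃ N₀ : ℕ, ∀ N, N₀ ≤ N → ∃ x : Fin (N + 1) → X, ∀ z : Fin (N + 1) → X,
      (∀ i, dist (z i) (x i) < ε) →
        dist (LevyProkhorov.ofMeasure (empiricalMeasure z)) μ ≤ 2 * ε := by
  classical
  obtain ⟨t, -, htf, ht⟩ := finite_cover_balls_of_compact (isCompact_univ (X := X)) hε
  obtain ⟨m, c, hc⟩ : ∃ (m : ℕ) (c : ℕ → X), ∀ y, ∃ j < m, y ∈ Metric.ball (c j) ε := by
    obtain ⟨x₀⟩ := ‹Nonempty X›
    let l := htf.toFinset.toList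
    refine ⟨l.length, fun j => l.getD j x₀, fun y => ?_⟩
    obtain ⟨x, hx, hy⟩ := Set.mem_iUnion₂.1 (ht (Set.mem_univ y))
    obtain ⟨j, hj, rfl⟩ := List.getElem_of_mem
      (show x ∈ l from Finset.mem_toList.2 (htf.mem_toFinset.2 hx))
    exact ⟨j, hj, by simpa [List.getElem?_eq_getElem hj] using hy⟩
  set A : ℕ → Set X := disjointed fun j => Metric.ball (c j) ε with hA
  have hAm : ∀ j, MeasurableSet (A j) := MeasurableSet.disjointed fun j => measurableSet_ball
  have hAd : Pairwise (Function.onFun Disjoint A) := disjoint_disjointed _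
  have hAsub : ∀ j, A j ⊆ Metric.ball (c j) ε := fun j => disjointed_subset _ j
  have hAcov : ∀ y, ∃ j < m, y ∈ A j := fun y => by
    have hex : ∃ j, y ∈ Metric.ball (c j) ε := (hc y).imp fun j h => h.2
    obtain ⟨j, hj, hy⟩ := hc y
    refine ⟨Nat.find hex, (Nat.find_min' hex hy).trans_lt hj, ?_⟩
    rw [hA, disjointed_apply]
    refine ⟨Nat.find_spec hex, fun h => ?_⟩
    simp only [Finset.sup_eq_iSup, Set.iSup_eq_iUnion, Set.mem_iUnion, Finset.mem_Iio] at h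
    obtain ⟨i, hi, hyi⟩ := h
    exact Nat.find_min hex hi hyi
  set ν : Measure X := (μ.toMeasure : Measure X) with hν
  obtain ⟨N₀, hN₀⟩ := exists_nat_gt ((m : ℝ) / ε)
  refine ⟨N₀, fun N hN => ?_⟩
  have hNε : (m : ℝ) / (N + 1) ≤ ε := by
    rw [div_le_iff₀ (by positivity)]
    rw [div_lt_iff₀ hε] at hN₀
    have : (N₀ : ℝ) ≤ N := by exact_mod_cast hN
    nlinarith
  let k : Fin m → ℕ := fun j => ⌊((N : ℝ) + 1) * ν.real (A j)⌋₊
  have hk : ∀ j : Fin m, (k j : ℝ) ≤ (N + 1) * ν.real (A j) := fun j =>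
    Nat.floor_le (by positivity)
  have hk' : ∀ j : Fin m, (N + 1) * ν.real (A j) ≤ k j + 1 := fun j => (Nat.lt_floor_add_one _).le
  have hsum : ∑ j : Fin m, ν.real (A j) ≤ 1 := by
    rw [← measureReal_iUnion_fintype (f := fun j : Fin m => A j)
      (fun i j hij => hAd (Fin.val_injective.ne hij)) fun j => hAm j]
    exact measureReal_le_one
  obtain ⟨e⟩ : Nonempty ((Σ j : Fin m, Fin (k j)) ↪ Fin (N + 1)) := by
    refine Function.Embedding.nonempty_of_card_le ?_
    have : ((∑ j, k j : ℕ) : ℝ) ≤ ((N + 1 : ℕ) : ℝ) := by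
      push_cast
      calc ∑ j, (k j : ℝ) ≤ ∑ j : Fin m, (N + 1) * ν.real (A j) := Finset.sum_le_sum fun j _ => hk j
        _ = (N + 1) * ∑ j : Fin m, ν.real (A j) := (Finset.mul_sum _ _ _).symm
        _ ≤ N + 1 := mul_le_of_le_one_right (by positivity) hsum
    simpa using Nat.cast_le.1 this
  refine ⟨Function.extend e (fun s => c s.1) fun _ => c 0, fun z hz => ?_⟩
  have hze : ∀ s : Σ j : Fin m, Fin (k j), dist (z (e s)) (c s.1) < ε := fun s => by
    have := hz (e s)
    rwa [e.injective.extend_apply] at this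
  rw [dist_comm, LevyProkhorov.dist_probabilityMeasure_def]
  refine levyProkhorovDist_le_of_forall_le _ _ (by positivity) fun δ B hδ hB => ?_
  let S : Finset (Fin m) := Finset.univ.filter fun j => (A j ∩ B).Nonempty
  have hT : MeasurableSet (Metric.thickening δ B) := Metric.isOpen_thickening.measurableSet
  have hcount : (∑ j ∈ S, k j) ≤ (z ⁻¹' Metric.thickening δ B).ncard := by
    have h1 : ((S.sigma fun j => (Finset.univ : Finset (Fin (k j)))).map e).card =
        ∑ j ∈ S, k j := by simp
    rw [← h1, ← Set.ncard_coe_finset]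
    refine Set.ncard_le_ncard (fun i hi => ?_) (Set.toFinite _)
    obtain ⟨s, hs, rfl⟩ := Finset.mem_map.1 (Finset.mem_coe.1 hi)
    obtain ⟨b, hbA, hbB⟩ := (Finset.mem_filter.1 (Finset.mem_sigma.1 hs).1).2
    refine Metric.mem_thickening_iff.2 ⟨b, hbB, ?_⟩
    have h2 : dist b (c s.1) < ε := hAsub _ hbA
    have h3 := dist_triangle_right (z (e s)) b (c s.1)
    linarith [hze s]
  have hBsub : B ⊆ ⋃ j ∈ S, A j := fun b hb => by
    obtain ⟨j, hj, hbj⟩ := hAcov b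
    exact Set.mem_biUnion (x := (⟨j, hj⟩ : Fin m))
      (Finset.mem_coe.2 (Finset.mem_filter.2 ⟨Finset.mem_univ _, b, hbj, hb⟩)) hbj
  have hreal : ν.real B ≤
      (empiricalMeasure z : Measure X).real (Metric.thickening δ B) + δ := by
    have h1 : ν.real B ≤ ∑ j ∈ S, ν.real (A j) :=
      (measureReal_mono hBsub (measure_ne_top _ _)).trans (measureReal_biUnion_finset_le _ _)
    have h2 : (N + 1) * ∑ j ∈ S, ν.real (A j) ≤ (∑ j ∈ S, k j : ℕ) + m := by
      rw [Finset.mul_sum]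
      refine (Finset.sum_le_sum fun j _ => hk' j).trans ?_
      rw [Finset.sum_add_distrib]
      push_cast
      have : S.card ≤ m := by simpa using Finset.card_le_univ S
      have : (S.card : ℝ) ≤ m := by exact_mod_cast this
      simpa using this
    have h3 : ((∑ j ∈ S, k j : ℕ) : ℝ) ≤ (z ⁻¹' Metric.thickening δ B).ncard := by
      exact_mod_cast hcount
    rw [empiricalMeasure_real z hT]
    have h4 : ∑ j ∈ S, ν.real (A j) ≤
        ((z ⁻¹' Metric.thickening δ B).ncard : ℝ) / (N + 1) + m / (N + 1) := by
      rw [← add_div, le_div_iff₀ (by positivity)]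
      linarith
    linarith
  rw [← ENNReal.ofReal_toReal (measure_ne_top ν B),
    ← ENNReal.ofReal_toReal (measure_ne_top _ (Metric.thickening δ B)),
    ← ENNReal.ofReal_add ENNReal.toReal_nonneg (by linarith)]
  exact ENNReal.ofReal_le_ofReal hreal

/-! ### Transitivity of the induced map -/

/-- If all finite products of `f` are transitive then so is the induced map: approximate a measure
in each of two given open sets by empirical measures with the same number of points, and move the
points of the one close to those of the other simultaneously. -/
theorem isTransitiveMap_inducedMap {X : Type*} [MetricSpace X] [CompactSpace X] [Nonempty X]
    [MeasurableSpace X] [BorelSpace X] (f : C(X, X))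
    (h : ∀ (N : ℕ) (U V : Fin (N + 1) → Set X), (∀ i, IsOpen (U i)) → (∀ i, IsOpen (V i)) →
      (∀ i, (U i).Nonempty) → (∀ i, (V i).Nonempty) →
      ∃ n, 1 ≤ n ∧ ∀ i, (f^[n] '' U i ∩ V i).Nonempty) :
    IsTransitiveMap (inducedMap f) := by
  intro U V hU hV ⟨μ, hμ⟩ ⟨ν, hν⟩
  obtain ⟨ε₁, hε₁, h₁⟩ := Metric.isOpen_iff.1 hU μ hμ
  obtain ⟨ε₂, hε₂, h₂⟩ := Metric.isOpen_iff.1 hV ν hν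
  obtain ⟨N₁, hN₁⟩ := exists_dist_empiricalMeasure_le μ (show 0 < ε₁ / 3 by positivity)
  obtain ⟨N₂, hN₂⟩ := exists_dist_empiricalMeasure_le ν (show 0 < ε₂ / 3 by positivity)
  obtain ⟨x, hx⟩ := hN₁ (max N₁ N₂) (le_max_left _ _)
  obtain ⟨y, hy⟩ := hN₂ (max N₁ N₂) (le_max_right _ _)
  obtain ⟨n, hn, hz⟩ := h _ (fun i => Metric.ball (x i) (ε₁ / 3))
    (fun i => Metric.ball (y i) (ε₂ / 3)) (fun _ => Metric.isOpen_ball)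
    (fun _ => Metric.isOpen_ball) (fun _ => Metric.nonempty_ball.2 (by positivity))
    (fun _ => Metric.nonempty_ball.2 (by positivity))
  have hz' : ∀ i, ∃ w, dist w (x i) < ε₁ / 3 ∧ dist (f^[n] w) (y i) < ε₂ / 3 := fun i => by
    obtain ⟨_, ⟨w, hw, rfl⟩, hw'⟩ := hz i
    exact ⟨w, hw, hw'⟩
  choose w hw hw' using hz'
  refine ⟨n, hn, _, ⟨LevyProkhorov.ofMeasure (empiricalMeasure w), h₁ ?_, rfl⟩, h₂ ?_⟩
  · exact Metric.mem_ball.2 ((hx w hw).trans_lt (by linarith))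
  · rw [iterate_inducedMap_empiricalMeasure]
    exact Metric.mem_ball.2 ((hy (f^[n] ∘ w) hw').trans_lt (by linarith))

theorem exists_lt_measure_of_nonempty {X : Type*} [MeasurableSpace X] {G : Set X}
    (hne : G.Nonempty) {c : ENNReal} (hc : c < 1) :
    ∃ μ : ProbSpace X, c < (μ.toMeasure : Measure X) G := by
  obtain ⟨x, hx⟩ := hne
  refine ⟨LevyProkhorov.ofMeasure ⟨Measure.dirac x, inferInstance⟩, ?_⟩
  exact hc.trans_eq (Measure.dirac_apply_of_mem hx).symm

/-- A measure giving `U` more than half of its mass whose image gives `V` more than half of its mass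
charges `U ∩ f^[n] ⁻¹' V`. -/
theorem isTransitiveMap_of_inducedMap {X : Type*} [PseudoMetricSpace X] [MeasurableSpace X]
    [BorelSpace X] (f : C(X, X)) (h : IsTransitiveMap (inducedMap f)) : IsTransitiveMap f := by
  intro U V hU hV hUne hVne
  obtain ⟨n, hn, -, ⟨μ, hμ, rfl⟩, hμV⟩ := h _ _ (isOpen_setOf_lt_measure hU 2⁻¹)
    (isOpen_setOf_lt_measure hV 2⁻¹)
    (exists_lt_measure_of_nonempty hUne ENNReal.one_half_lt_one)
    (exists_lt_measure_of_nonempty hVne ENNReal.one_half_lt_one)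
  refine ⟨n, hn, ?_⟩
  rw [Set.mem_ofPred_eq, iterate_inducedMap_apply f n μ hV.measurableSet] at hμV
  have hm : MeasurableSet (f^[n] ⁻¹' V) := (f.continuous.iterate n).measurable hV.measurableSet
  obtain ⟨x, hxU, hxV⟩ := nonempty_inter_of_measure_lt_add (μ.toMeasure : Measure X) hm
    (Set.subset_univ U) (Set.subset_univ _) (by
      rw [measure_univ, ← ENNReal.inv_two_add_inv_two]
      exact ENNReal.add_lt_add hμ hμV)
  exact ⟨f^[n] x, ⟨x, hxU, rfl⟩, hxV⟩

/-! ### A transitive map exchanging two intervals -/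

/-- The odd piecewise linear map of the line with slopes `2`, `-2`, `2` and corners at `-1/2` and
`1/2`. It maps each of `[-1, 0]` and `[0, 1]` onto the other one in two full affine pieces. -/
noncomputable def zigzag (x : ℝ) : ℝ := 2 * x - |2 * x + 1| + |2 * x - 1|

theorem zigzag_of_le {x : ℝ} (h : x ≤ -1 / 2) : zigzag x = 2 * x + 2 := by
  rw [zigzag, abs_of_nonpos (by linarith), abs_of_nonpos (by linarith)]
  ring

theorem zigzag_of_mem {x : ℝ} (h : -1 / 2 ≤ x) (h' : x ≤ 1 / 2) : zigzag x = -2 * x := by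
  rw [zigzag, abs_of_nonneg (by linarith), abs_of_nonpos (by linarith)]
  ring

theorem zigzag_of_ge {x : ℝ} (h : 1 / 2 ≤ x) : zigzag x = 2 * x - 2 := by
  rw [zigzag, abs_of_nonneg (by linarith), abs_of_nonneg (by linarith)]
  ring

theorem zigzag_of_nonneg {x : ℝ} (h0 : 0 ≤ x) (h1 : x ≤ 1) : zigzag x ∈ Set.Icc (-1) 0 := by
  rcases le_total x (1 / 2) with h | h
  · rw [zigzag_of_mem (by linarith) h]
    constructor <;> linarith
  · rw [zigzag_of_ge h]
    constructor <;> linarith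

theorem zigzag_of_nonpos {x : ℝ} (h0 : x ≤ 0) (h1 : -1 ≤ x) : zigzag x ∈ Set.Icc 0 1 := by
  rcases le_total x (-1 / 2) with h | h
  · rw [zigzag_of_le h]
    constructor <;> linarith
  · rw [zigzag_of_mem h (by linarith)]
    constructor <;> linarith

/-- The restriction of `zigzag` to `[-1, 1]`. -/
noncomputable def zigzagMap : C(Set.Icc (-1 : ℝ) 1, Set.Icc (-1 : ℝ) 1) where
  toFun x := ⟨zigzag x, by
    rcases le_total (x : ℝ) 0 with h | h
    · have := zigzag_of_nonpos h x.2.1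
      exact ⟨by linarith [this.1], this.2⟩
    · have := zigzag_of_nonneg h x.2.2
      exact ⟨this.1, by linarith [this.2]⟩⟩
  continuous_toFun := by
    unfold zigzag
    fun_prop

theorem coe_zigzagMap (x : Set.Icc (-1 : ℝ) 1) : (zigzagMap x : ℝ) = zigzag x := rfl

theorem mapsTo_zigzagMap_nonneg :
    Set.MapsTo zigzagMap {x | 0 ≤ (x : ℝ)} {x | (x : ℝ) ≤ 0} :=
  fun x hx => (zigzag_of_nonneg hx x.2.2).2

theorem mapsTo_zigzagMap_nonpos :
    Set.MapsTo zigzagMap {x | (x : ℝ) ≤ 0} {x | 0 ≤ (x : ℝ)} :=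
  fun x hx => (zigzag_of_nonpos hx x.2.1).1

theorem isPiecewiseLinear_zigzagMap : IsPiecewiseLinear zigzagMap := by
  refine ⟨3, ![-1, -1 / 2, 1 / 2, 1], ?_, rfl, rfl, fun i => ?_⟩
  · refine Fin.strictMono_iff_lt_succ.2 fun i => ?_
    fin_cases i
    · show (-1 : ℝ) < -1 / 2
      norm_num
    · show (-1 / 2 : ℝ) < 1 / 2
      norm_num
    · show (1 / 2 : ℝ) < 1
      norm_num
  · fin_cases i
    · exact ⟨2, 2, fun x _ h => zigzag_of_le h⟩
    · exact ⟨-2, 0, fun x h h' => (zigzag_of_mem h h').trans (add_zero _).symm⟩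
    · exact ⟨2, -2, fun x h _ => (zigzag_of_ge h).trans (sub_eq_add_neg _ _)⟩

theorem not_hasOddPeriodNeOne_zigzagMap : ¬ HasOddPeriodNeOne zigzagMap := fun h =>
  h.not_swap mapsTo_zigzagMap_nonneg mapsTo_zigzagMap_nonpos
    (Set.eq_univ_of_forall fun x => le_total (0 : ℝ) x)
    (z := ⟨0, by norm_num⟩)
    (Subtype.ext ((coe_zigzagMap _).trans ((zigzag_of_mem (by norm_num) (by norm_num)).trans
      (mul_zero _))))
    fun _ h0 h1 => Subtype.ext (le_antisymm h1 h0)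

/-- The preimages of a point under the `n`-th iterate are `2⁻ⁿ`-dense in the half of `[-1, 1]` that
the iterate maps to the half containing the point; the sign `s` selects the half. -/
theorem exists_iterate_zigzagMap_eq (n : ℕ) :
    ∀ (s : ℝ), s = 1 ∨ s = -1 → ∀ x y : Set.Icc (-1 : ℝ) 1, 0 ≤ s * x → 0 ≤ (-1) ^ n * s * y →
      ∃ w : Set.Icc (-1 : ℝ) 1, 0 ≤ s * w ∧ |(w : ℝ) - x| ≤ (1 / 2) ^ n ∧ zigzagMap^[n] w = y := by
  induction n with
  | zero =>
    intro s hs x y hx hy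
    refine ⟨y, by simpa using hy, ?_, rfl⟩
    have hy' : 0 ≤ s * y := by simpa using hy
    have := x.2.1
    have := x.2.2
    have := y.2.1
    have := y.2.2
    rw [pow_zero, abs_le]
    rcases hs with rfl | rfl <;> constructor <;> linarith
  | succ n ih =>
    intro s hs x y hx hy
    have hfx : 0 ≤ -s * zigzagMap x := by
      rcases hs with rfl | rfl
      · have := (zigzag_of_nonneg (by linarith : (0 : ℝ) ≤ x) x.2.2).2
        rw [coe_zigzagMap]
        linarith
      · have := (zigzag_of_nonpos (by linarith : (x : ℝ) ≤ 0) x.2.1).1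
        rw [coe_zigzagMap]
        linarith
    obtain ⟨w', hw's, hw'd, hw'⟩ := ih (-s) (by rcases hs with rfl | rfl <;> simp) (zigzagMap x) y
      hfx (by rw [pow_succ] at hy; linarith)
    have h1 := w'.2.1
    have h2 := w'.2.2
    -- It suffices to find a preimage `v` of `w'` at half the distance.
    suffices h : ∃ v : ℝ, v ∈ Set.Icc (-1 : ℝ) 1 ∧ 0 ≤ s * v ∧
        |v - x| = |(w' : ℝ) - zigzagMap x| / 2 ∧ zigzag v = w' by
      obtain ⟨v, hv, hsv, hd, hz⟩ := h
      refine ⟨⟨v, hv⟩, hsv, ?_, ?_⟩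
      · rw [hd, pow_succ]
        linarith
      · rw [Function.iterate_succ_apply, show zigzagMap ⟨v, hv⟩ = w' from Subtype.ext hz, hw']
    have hhalf : ∀ {u r : ℝ}, u = r / 2 ∨ u = -(r / 2) → |u| = |r| / 2 := by
      rintro u r (rfl | rfl)
      · rw [abs_div, abs_of_pos (by norm_num : (0 : ℝ) < 2)]
      · rw [abs_neg, abs_div, abs_of_pos (by norm_num : (0 : ℝ) < 2)]
    rcases hs with rfl | rfl
    · rcases le_total (x : ℝ) (1 / 2) with h | h
      · refine ⟨-w' / 2, ⟨by linarith, by linarith⟩, by linarith, hhalf ?_, ?_⟩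
        · rw [coe_zigzagMap, zigzag_of_mem (by linarith) h]
          right; ring
        · rw [zigzag_of_mem (by linarith) (by linarith)]; ring
      · refine ⟨1 + w' / 2, ⟨by linarith, by linarith⟩, by linarith, hhalf ?_, ?_⟩
        · rw [coe_zigzagMap, zigzag_of_ge h]
          left; ring
        · rw [zigzag_of_ge (by linarith)]; ring
    · rcases le_total (-1 / 2) (x : ℝ) with h | h
      · refine ⟨-w' / 2, ⟨by linarith, by linarith⟩, by linarith, hhalf ?_, ?_⟩
        · rw [coe_zigzagMap, zigzag_of_mem h (by linarith)]
          right; ring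
        · rw [zigzag_of_mem (by linarith) (by linarith)]; ring
      · refine ⟨-1 + w' / 2, ⟨by linarith, by linarith⟩, by linarith, hhalf ?_, ?_⟩
        · rw [coe_zigzagMap, zigzag_of_le h]
          left; ring
        · rw [zigzag_of_le (by linarith)]; ring

theorem isTransitiveMap_zigzagMap : IsTransitiveMap zigzagMap := by
  intro U V hU hV ⟨x, hx⟩ ⟨y, hy⟩
  obtain ⟨ε, hε, hsub⟩ := Metric.isOpen_iff.1 hU x hx
  obtain ⟨m, hm⟩ := exists_pow_lt_of_lt_one hε (by norm_num : (1 / 2 : ℝ) < 1)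
  obtain ⟨s, hs, hsx⟩ : ∃ s : ℝ, (s = 1 ∨ s = -1) ∧ 0 ≤ s * x := by
    rcases le_total 0 (x : ℝ) with h | h
    · exact ⟨1, Or.inl rfl, by linarith⟩
    · exact ⟨-1, Or.inr rfl, by linarith⟩
  -- The parity of `n` is dictated by the halves containing `x` and `y`.
  obtain ⟨n, hmn, hn, hny⟩ : ∃ n, m ≤ n ∧ 1 ≤ n ∧ 0 ≤ (-1) ^ n * s * (y : ℝ) := by
    rcases le_total 0 (s * (y : ℝ)) with h | h
    · refine ⟨2 * (m + 1), by omega, by omega, ?_⟩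
      rw [pow_mul]
      simpa using h
    · refine ⟨2 * m + 1, by omega, by omega, ?_⟩
      rw [pow_succ, pow_mul]
      simpa using h
  obtain ⟨w, -, hwd, hw⟩ := exists_iterate_zigzagMap_eq n s hs x y hsx hny
  refine ⟨n, hn, y, ⟨w, hsub ?_, hw⟩, hy⟩
  rw [Metric.mem_ball, Subtype.dist_eq, Real.dist_eq]
  exact hwd.trans_lt ((pow_le_pow_of_le_one (by norm_num) (by norm_num) hmn).trans_lt hm)

/-- Each image of a measure with more than two thirds of its mass on the right of `0` gives more
than two thirds to one of the two closed halves, so it cannot give more than a third to each side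
of `0`. -/
theorem not_isTransitiveMap_inducedMap_zigzagMap :
    ¬ IsTransitiveMap (inducedMap zigzagMap) := by
  intro h
  let G : Set (Set.Icc (-1 : ℝ) 1) := {x | 0 < (x : ℝ)}
  let H : Set (Set.Icc (-1 : ℝ) 1) := {x | (x : ℝ) < 0}
  have hG : IsOpen G := isOpen_lt continuous_const continuous_subtype_val
  have hH : IsOpen H := isOpen_lt continuous_subtype_val continuous_const
  let z : Fin 2 → Set.Icc (-1 : ℝ) 1 := ![⟨1, by norm_num⟩, ⟨-1, by norm_num⟩]
  have hbal : ∀ K : Set (Set.Icc (-1 : ℝ) 1), IsOpen K → (z ⁻¹' K).ncard = 1 →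
      3⁻¹ < (empiricalMeasure z : Measure (Set.Icc (-1 : ℝ) 1)) K := by
    intro K hK hc
    refine (ENNReal.toReal_lt_toReal (by simp) (measure_ne_top _ _)).1 ?_
    rw [← Measure.real, empiricalMeasure_real z hK.measurableSet, hc]
    norm_num
  have hzG : z ⁻¹' G = {0} := by
    ext i
    fin_cases i <;> simp [z, G]
  have hzH : z ⁻¹' H = {1} := by
    ext i
    fin_cases i <;> simp [z, H]
  obtain ⟨n, -, -, ⟨μ, hμ, rfl⟩, hνG, hνH⟩ := h _ _ (isOpen_setOf_lt_measure hG (1 - 3⁻¹))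
    ((isOpen_setOf_lt_measure hG 3⁻¹).inter (isOpen_setOf_lt_measure hH 3⁻¹))
    (exists_lt_measure_of_nonempty ⟨⟨1, by norm_num⟩, zero_lt_one (α := ℝ)⟩
      (ENNReal.sub_lt_self (by simp) (by simp) (by simp)))
    ⟨LevyProkhorov.ofMeasure (empiricalMeasure z), hbal G hG (by rw [hzG, Set.ncard_singleton]),
      hbal H hH (by rw [hzH, Set.ncard_singleton])⟩
  have hmeet : ∀ K : Set (Set.Icc (-1 : ℝ) 1), IsOpen K →
      3⁻¹ < (((inducedMap zigzagMap)^[n] μ).toMeasure : Measure (Set.Icc (-1 : ℝ) 1)) K →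
      ∃ x ∈ G, zigzagMap^[n] x ∈ K := by
    intro K hK hK'
    rw [iterate_inducedMap_apply zigzagMap n μ hK.measurableSet] at hK'
    refine nonempty_inter_of_measure_lt_add
      (μ.toMeasure : Measure (Set.Icc (-1 : ℝ) 1))
      ((zigzagMap.continuous.iterate n).measurable hK.measurableSet)
      (Set.subset_univ G) (Set.subset_univ _) ?_
    rw [measure_univ, ← tsub_add_cancel_of_le (show (3⁻¹ : ENNReal) ≤ 1 by simp)]
    exact ENNReal.add_lt_add hμ hK'
  have h2 : ∀ m, Set.MapsTo zigzagMap^[2 * m] {x | 0 ≤ (x : ℝ)} {x | 0 ≤ (x : ℝ)} := fun m => by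
    rw [Function.iterate_mul]
    exact (mapsTo_zigzagMap_nonpos.comp mapsTo_zigzagMap_nonneg).iterate m
  rcases Nat.even_or_odd' n with ⟨m, rfl | rfl⟩
  · obtain ⟨x, hx, hxH⟩ := hmeet H hH hνH
    have h0 := h2 m (le_of_lt (show (0 : ℝ) < x from hx))
    exact lt_irrefl (0 : ℝ) (lt_of_le_of_lt h0 hxH)
  · obtain ⟨x, hx, hxG⟩ := hmeet G hG hνG
    rw [Function.iterate_succ_apply'] at hxG
    have h0 := mapsTo_zigzagMap_nonneg (h2 m (le_of_lt (show (0 : ℝ) < x from hx)))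
    exact lt_irrefl (0 : ℝ) (lt_of_lt_of_le hxG h0)

/-! ### Interval maps with an odd period -/

theorem theorem2p2 :
    (∀ (a b : ℝ), a < b → ∀ f : C(Set.Icc a b, Set.Icc a b), HasOddPeriodNeOne f →
      (IsTransitiveMap f ↔ IsTransitiveMap (inducedMap f))) ∧
    (∃ (a b : ℝ), a < b ∧ ∃ f : C(Set.Icc a b, Set.Icc a b),
      IsPiecewiseLinear f ∧ ¬ HasOddPeriodNeOne f ∧
        IsTransitiveMap f ∧ ¬ IsTransitiveMap (inducedMap f)) := by
  refine ⟨fun a b hab f ho => ⟨fun hT => ?_, isTransitiveMap_of_inducedMap f⟩,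
    -1, 1, by norm_num, zigzagMap, isPiecewiseLinear_zigzagMap, not_hasOddPeriodNeOne_zigzagMap,
    isTransitiveMap_zigzagMap, not_isTransitiveMap_inducedMap_zigzagMap⟩
  -- The complete linear order on `[a, b]` is an instance under this fact.
  have : Fact (a ≤ b) := ⟨hab.le⟩
  have : Nonempty (Set.Icc a b) := ⟨⟨a, le_rfl, hab.le⟩⟩
  exact isTransitiveMap_inducedMap f fun N U V hU hV hUne hVne =>
    hT.exists_forall_inter_nonempty f.continuous ho U V hU hV hUne hVne
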